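/- Let $d = 39028039587479$, let $K=\mathbb{Q}(\sqrt d)\subset\mathbb{R}$, and let $\mathcal{O}_K$ be the ring of algebraic integers of $K$. Then $d$ is prime, $d\equiv 3 \pmod 4$, and $\mathcal{O}_K=\mathbb{Z}[\sqrt d]$. Let $\varepsilon>1$ be the fundamental unit of $\mathcal{O}_K$, that is, the unit $\varepsilon>1$ such that every unit of $\mathcal{O}_K$ is of the form $\pm\varepsilon^k$ with $k\in\mathbb{Z}$. Such an $\varepsilon$ exists, it can be written as $\varepsilon=x+y\sqrt d$ with integers $x,y\ge 0$, and $d\mid y$. Consequently, the Pellian equation conjecture of Mordell is false, namely the assertion that for every prime $p\equiv 3\pmod 4$, if $x+y\sqrt p$ with integers $x,y\ge 0$ is the fundamental unit $>1$ of the ring of algebraic integers of $\mathbb{Q}(\sqrt p)$, then $p\nmid y$. -/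

import Mathlib

open scoped NumberField IntermediateField

noncomputable section

/-- The real quadratic field `ℚ(√d)`, as a subfield of `ℝ`. -/
abbrev RealQuadraticField (d : ℕ) : IntermediateField ℚ ℝ :=
  ℚ⟮Real.sqrt (d : ℝ)⟯

/-- The real number underlying a unit of the ring of integers of `ℚ(√d)`. -/
def unitToReal {d : ℕ} (u : (𝓞 (RealQuadraticField d))ˣ) : ℝ :=
  (((u : 𝓞 (RealQuadraticField d)) : RealQuadraticField d) : ℝ)

/-- `ε` is the fundamental unit of the ring of integers of `ℚ(√d)`: it is greater than `1`, and
every unit is of the form `± ε ^ k` with `k` an integer. -/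
def IsFundamentalUnit {d : ℕ} (ε : (𝓞 (RealQuadraticField d))ˣ) : Prop :=
  1 < unitToReal ε ∧ ∀ u : (𝓞 (RealQuadraticField d))ˣ, ∃ k : ℤ, u = ε ^ k ∨ u = -ε ^ k

/-- Mordell's Pellian equation conjecture: if `d` is a prime with `d ≡ 3 (mod 4)` and
`x + y √d` is the fundamental unit of the ring of integers of `ℚ(√d)`, then `d ∤ y`. -/
def MordellPellianConjecture : Prop :=
  ∀ d : ℕ, d.Prime → d ≡ 3 [MOD 4] →
    ∀ ε : (𝓞 (RealQuadraticField d))ˣ, IsFundamentalUnit ε →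
      ∀ x y : ℕ, unitToReal ε = (x : ℝ) + (y : ℝ) * Real.sqrt (d : ℝ) → ¬ d ∣ y

end

/-! It is enough to find one nontrivial Pell solution `X + Y√d` with `d ∣ Y` and `|X| < 2 ^ d`. It
is, up to signs, a power `ε ^ n` of the fundamental solution `x + y√d`, and `2 ^ n ≤ |X|` forces `n
< d`. Modulo `d` the binomial theorem gives `Y ≡ ± n x ^ (n - 1) y`. The prime `d` divides neither
`n` nor `x` (the norm is 1), so `d ∣ y`.

Such a solution has millions of digits, so it is never written out. It is given by a compact
representation: a chain of repeated squarings, each multiplied by a small `u + v√d` and divided by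
`Q ^ 2`. Only norm, ideal, residues modulo `d ^ 2` and a size bound are carried along
(`GeneratorResidues.next`).

Since `d ≡ 3 (mod 4)`, the integers of `ℚ(√d)` are `ℤ[√d]` and no unit has norm `-1`, so units are
exactly Pell solutions. -/

/-! ### Compact representation of a large Pell solution -/

/-- There are integers `x` and `y`, with absolute values at most `2 ^ B` and residues `a` and `b`
modulo `M`, such that `x + y √d` has norm `Q` and lies in the ideal `(Q, P + √d)` of `ℤ[√d]`. -/
def GeneratorResidues (d M Q P a b : ℤ) (B : ℕ) : Prop :=
  ∃ x y : ℤ, x ^ 2 - d * y ^ 2 = Q ∧ Q ∣ x - P * y ∧ M ∣ x - a ∧ M ∣ y - b ∧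
    |x| ≤ 2 ^ B ∧ |y| ≤ 2 ^ B

theorem generatorResidues_one (d M : ℤ) : GeneratorResidues d M 1 0 1 0 0 :=
  ⟨1, 0, by norm_num, by norm_num, by norm_num, by norm_num, by norm_num, by norm_num⟩

theorem abs_mul_add_mul_le {a b c e X Y m n : ℤ} (ha : |a| ≤ X) (hb : |b| ≤ Y)
    (hc : |c| ≤ m) (he : |e| ≤ n) : |a * c + b * e| ≤ X * m + Y * n := by
  refine (abs_add_le _ _).trans ?_
  rw [abs_mul, abs_mul]
  have := (abs_nonneg a).trans ha
  have := (abs_nonneg b).trans hb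
  gcongr

/-- If `x + y √d` generates `(Q, P + √d)` and `u + v √d` lies in the conjugate of the square of
this ideal, then the quotient of `(x + y √d) ^ 2 * (u + v √d)` by `Q ^ 2` is integral. -/
theorem GeneratorResidues.next {d M Q P a b : ℤ} {B : ℕ} (h : GeneratorResidues d M Q P a b B)
    (u v Q' P' a' b' : ℤ)
    (hc : Q ≠ 0 ∧ 0 ≤ d ∧ Q ^ 2 ∣ P ^ 2 - d ∧ Q ^ 2 ∣ u + P * v ∧
      u ^ 2 - d * v ^ 2 = Q ^ 2 * Q' ∧ Q' ∣ u - P' * v ∧ Q' ∣ P' ^ 2 - d ∧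
      Int.gcd Q' (Q ^ 2) = 1 ∧ Int.gcd M (Q ^ 2) = 1 ∧
      M ∣ Q ^ 2 * a' - ((a ^ 2 + d * b ^ 2) * u + d * (2 * a * b) * v) ∧
      M ∣ Q ^ 2 * b' - ((a ^ 2 + d * b ^ 2) * v + 2 * a * b * u) ∧
      (1 + d) * |u| + 2 * (d * |v|) ≤ 2 ^ 93 ∧ (1 + d) * |v| + 2 * |u| ≤ 2 ^ 93) :
    GeneratorResidues d M Q' P' a' b' (2 * B + 93) := by
  obtain ⟨x, y, hn, ⟨r, hr⟩, ⟨i, hi⟩, ⟨j, hj⟩, hx, hy⟩ := h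
  obtain ⟨hQ, hd, ⟨p, hp⟩, ⟨w, hw⟩, hn', hQ', hP', hc1, hc2, ha', hb', hu, hv⟩ := hc
  have hQ2 : Q ^ 2 ≠ 0 := pow_ne_zero 2 hQ
  set X := x ^ 2 + d * y ^ 2 with hX
  set Y := 2 * x * y with hY
  -- The square of the generator lies in `(Q ^ 2, P + √d)`; this uses `Q ^ 2 ∣ P ^ 2 - d`, so `P`
  -- matters modulo `Q ^ 2`, not just `Q`.
  have hXY : X = P * Y + Q ^ 2 * (r ^ 2 - p * y ^ 2) := by
    linear_combination (exp := 1) (x - P * y + Q * r) * hr - y ^ 2 * hp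
  obtain ⟨x', hx'⟩ : Q ^ 2 ∣ X * u + d * Y * v :=
    ⟨P * Y * w + (r ^ 2 - p * y ^ 2) * u - Y * v * p, by
      linear_combination u * hXY + P * Y * hw - Y * v * hp⟩
  obtain ⟨y', hy'⟩ : Q ^ 2 ∣ X * v + Y * u :=
    ⟨(r ^ 2 - p * y ^ 2) * v + Y * w, by linear_combination v * hXY + Y * hw⟩
  have hXn : |X| ≤ (1 + d) * 2 ^ (2 * B) := by
    have h1 : x ^ 2 ≤ 2 ^ (2 * B) := by
      rw [← sq_abs, mul_comm 2 B, pow_mul]; gcongr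
    have h2 : y ^ 2 ≤ 2 ^ (2 * B) := by
      rw [← sq_abs, mul_comm 2 B, pow_mul]; gcongr
    rw [abs_of_nonneg (by positivity)]
    nlinarith
  have hYn : |Y| ≤ 2 * 2 ^ (2 * B) := by
    rw [hY, abs_mul, abs_mul, abs_two, mul_assoc, two_mul B, pow_add]
    gcongr
  have hXM : M ∣ X - (a ^ 2 + d * b ^ 2) :=
    ⟨i * (x + a) + d * j * (y + b), by linear_combination (x + a) * hi + d * (y + b) * hj⟩
  have hYM : M ∣ Y - 2 * a * b :=
    ⟨2 * (i * y + a * j), by linear_combination 2 * y * hi + 2 * a * hj⟩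
  have hle : ∀ z t : ℤ, t = Q ^ 2 * z → |z| ≤ |t| := by
    rintro z t rfl
    rw [abs_mul]
    exact le_mul_of_one_le_left (abs_nonneg _) (Int.one_le_abs hQ2)
  have hB : (0 : ℤ) ≤ 2 ^ (2 * B) := by positivity
  refine ⟨x', y', ?_, ?_, ?_, ?_, ?_, ?_⟩
  · apply mul_left_cancel₀ (pow_ne_zero 2 hQ2)
    have : (Q ^ 2) ^ 2 * (x' ^ 2 - d * y' ^ 2) = (X ^ 2 - d * Y ^ 2) * (u ^ 2 - d * v ^ 2) := by
      linear_combination -(X * u + d * Y * v + Q ^ 2 * x') * hx' +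
        d * (X * v + Y * u + Q ^ 2 * y') * hy'
    rw [this, hn', show X ^ 2 - d * Y ^ 2 = (x ^ 2 - d * y ^ 2) ^ 2 by rw [hX, hY]; ring, hn]
    ring
  · refine Int.dvd_of_dvd_mul_right_of_gcd_one ?_ hc1
    -- Reduction modulo `(Q', P' + √d)` sends `√d` to `-P'` and is multiplicative.
    rw [show Q ^ 2 * (x' - P' * y') = (X - P' * Y) * (u - P' * v) - Y * v * (P' ^ 2 - d) by
      linear_combination -hx' + P' * hy']
    exact dvd_sub (hQ'.mul_left _) (hP'.mul_left _)
  · refine Int.dvd_of_dvd_mul_right_of_gcd_one ?_ hc2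
    rw [show Q ^ 2 * (x' - a') = (X - (a ^ 2 + d * b ^ 2)) * u + (Y - 2 * a * b) * (d * v) -
      (Q ^ 2 * a' - ((a ^ 2 + d * b ^ 2) * u + d * (2 * a * b) * v)) by linear_combination -hx']
    exact dvd_sub (dvd_add (hXM.mul_right _) (hYM.mul_right _)) ha'
  · refine Int.dvd_of_dvd_mul_right_of_gcd_one ?_ hc2
    rw [show Q ^ 2 * (y' - b') = (X - (a ^ 2 + d * b ^ 2)) * v + (Y - 2 * a * b) * u -
      (Q ^ 2 * b' - ((a ^ 2 + d * b ^ 2) * v + 2 * a * b * u)) by linear_combination -hy']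
    exact dvd_sub (dvd_add (hXM.mul_right _) (hYM.mul_right _)) hb'
  · refine (hle _ _ hx').trans ?_
    rw [show X * u + d * Y * v = X * u + Y * (d * v) by ring, pow_add]
    refine (abs_mul_add_mul_le hXn hYn le_rfl le_rfl).trans ?_
    rw [abs_mul d v, abs_of_nonneg hd]
    nlinarith
  · refine (hle _ _ hy').trans ?_
    rw [pow_add]
    refine (abs_mul_add_mul_le hXn hYn le_rfl le_rfl).trans ?_
    nlinarith

/-- The chain returns to the unit ideal with norm 1. Nineteen steps give `B = 93 * (2 ^ 19 - 1)`,
about `4.9 * 10 ^ 7`, far below `d`. Working modulo `d ^ 2` rather than `d` is what later shows `y ≠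
0`. -/
theorem generatorResidues_final :
    ∃ B : ℕ, B < 39028039587479 ∧ GeneratorResidues 39028039587479 (39028039587479 ^ 2) 1 0 1
      (39028039587479 * 24152907212873) B := by
  have h : GeneratorResidues 39028039587479 (39028039587479 ^ 2) 1 0 1 0 0 :=
    generatorResidues_one _ _
  replace h := h.next 6247242 1 (-6980915) 39397979824377
    6247242
    1 (by norm_num)
  replace h := h.next 70735945165183 11322746 12983357 102750969093308
    226595946371189
    36271354 (by norm_num)
  replace h := h.next 19307104686128 3090517 (-23971303) 32455376185118
    676042350222443932653692189
    3765478967679254857169 (by norm_num)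
  replace h := h.next 151339165683105 24224954 1091029 759590264149
    780472197228680735632084530
    201162908818921900725667508 (by norm_num)
  replace h := h.next 4368664505259 699296 (-53048063) 1829616706759796
    140097398020925175061761108
    876221533472731026244701685 (by norm_num)
  replace h := h.next 138756896527331 22210902 422605 56024265023
    88098831603227958316460633
    94060529546129746658834296 (by norm_num)
  replace h := h.next 2302102653748 368499 466681 44458384071
    124199945574282393271544289
    477185542573725650067095403 (by norm_num)
  replace h := h.next 90666497420 14513 221609 21621507011
    708233499782405423473969150
    153901877852976267349966748 (by norm_num)
  replace h := h.next 2569965940 411 245761 17154407317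
    1028114504482759826151273869
    197304976054598766843580393 (by norm_num)
  replace h := h.next 4049362949 630 15018781 177442900388493
    903560158022356102623250026
    1503004149396989485640197750 (by norm_num)
  replace h := h.next 65337890201547 10458680 (-11935631) 46878012394194
    384429082343766028323925588
    42397233863545068982482769 (by norm_num)
  replace h := h.next 84603474125726 13542531 (-2245163) 3672100597204
    527258414588673762784569939
    403944999376532660903665153 (by norm_num)
  replace h := h.next 7228520858125 1157074 (-3092491) 1626902682711
    43902914362900057971239780
    342045715262363175407656013 (by norm_num)
  replace h := h.next 6171245286122 987835 558989 139101696440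
    887777571376140340971199176
    1269307878090523362352793266 (by norm_num)
  replace h := h.next 94038097941 15052 2770465 6824672844548
    596845616752843119453420750
    342245476327500904942952225 (by norm_num)
  replace h := h.next 112652089243 18034 (-313603) 47965254427
    828867292970980819022508468
    1286987642866818281403366295 (by norm_num)
  replace h := h.next 5895882724 941 2062553 3375980730499
    634986432385362654924810379
    248163417228372583302946014 (by norm_num)
  replace h := h.next 3737438555022 598255 (-9737699) 24508194890822
    98264066860671926833674956
    1008172259465827953556337668 (by norm_num)
  replace h := h.next 39028029849780 6247241 1 0
    1
    (39028039587479 * 24152907212873) (by norm_num)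
  exact ⟨_, by norm_num, h⟩

/-! ### The ring of integers is `ℤ[√d]` -/

theorem exists_rat_of_mem_realQuadraticField {d : ℕ} {z : ℝ} (hz : z ∈ RealQuadraticField d) :
    ∃ a b : ℚ, z = a + b * √(d : ℝ) := by
  have hs : √(d : ℝ) * √(d : ℝ) = d := Real.mul_self_sqrt (Nat.cast_nonneg d)
  have hi : IsAlgebraic ℚ √(d : ℝ) :=
    ⟨Polynomial.X ^ 2 - Polynomial.C (d : ℚ), Polynomial.X_pow_sub_C_ne_zero two_pos _, by
      simp⟩
  rw [← IntermediateField.mem_toSubalgebra,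
    IntermediateField.adjoin_simple_toSubalgebra_of_isAlgebraic hi] at hz
  induction hz using Algebra.adjoin_induction with
  | mem x hx => exact ⟨0, 1, by simp_all⟩
  | algebraMap r => exact ⟨r, 0, by simp⟩
  | add x y _ _ hx hy =>
    obtain ⟨a, b, rfl⟩ := hx
    obtain ⟨a', b', rfl⟩ := hy
    exact ⟨a + a', b + b', by push_cast; ring⟩
  | mul x y _ _ hx hy =>
    obtain ⟨a, b, rfl⟩ := hx
    obtain ⟨a', b', rfl⟩ := hy
    exact ⟨a * a' + d * b * b', a * b' + a' * b, by push_cast; linear_combination b * b' * hs⟩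

theorem mem_adjoin_int_sqrt_iff (d : ℕ) (z : ℝ) :
    z ∈ Algebra.adjoin ℤ {√(d : ℝ)} ↔ ∃ x y : ℤ, z = x + y * √(d : ℝ) := by
  have hs : √(d : ℝ) * √(d : ℝ) = d := Real.mul_self_sqrt (Nat.cast_nonneg d)
  constructor
  · intro hz
    induction hz using Algebra.adjoin_induction with
    | mem x hx => exact ⟨0, 1, by simp_all⟩
    | algebraMap r => exact ⟨r, 0, by simp⟩
    | add x y _ _ hx hy =>
      obtain ⟨a, b, rfl⟩ := hx
      obtain ⟨a', b', rfl⟩ := hy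
      exact ⟨a + a', b + b', by push_cast; ring⟩
    | mul x y _ _ hx hy =>
      obtain ⟨a, b, rfl⟩ := hx
      obtain ⟨a', b', rfl⟩ := hy
      exact ⟨a * a' + d * b * b', a * b' + a' * b, by push_cast; linear_combination b * b' * hs⟩
  · rintro ⟨x, y, rfl⟩
    exact add_mem (intCast_mem _ x)
      (mul_mem (intCast_mem _ y) (Algebra.subset_adjoin (Set.mem_singleton _)))

theorem irrational_sqrt_prime {d : ℕ} (hd : d.Prime) {a b : ℚ}
    (h : (a : ℝ) + b * √(d : ℝ) = 0) : a = 0 ∧ b = 0 := by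
  have hb : b = 0 := by
    by_contra hb
    exact (hd.irrational_sqrt.ratCast_mul hb).ratCast_add a |>.ne_zero h
  subst hb
  simpa using h

/-- The conjugate of an integral element of `ℚ(√d)` is integral. -/
theorem isIntegral_conj {d : ℕ} (hd : d.Prime) {a b : ℚ}
    (h : IsIntegral ℤ ((a : ℝ) + b * √(d : ℝ))) : IsIntegral ℤ ((a : ℝ) - b * √(d : ℝ)) := by
  have hs : √(d : ℝ) * √(d : ℝ) = d := Real.mul_self_sqrt (Nat.cast_nonneg d)
  -- Integer polynomials commute with conjugation, so a monic one vanishing at `a + b√d` also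
  -- vanishes at its conjugate.
  have key : ∀ p : Polynomial ℤ, ∃ A B : ℚ,
      p.aeval ((a : ℝ) + b * √(d : ℝ)) = A + B * √(d : ℝ) ∧
      p.aeval ((a : ℝ) - b * √(d : ℝ)) = A - B * √(d : ℝ) := by
    intro p
    induction p using Polynomial.induction_on with
    | C n => exact ⟨n, 0, by simp, by simp⟩
    | add p q hp hq =>
      obtain ⟨A, B, h1, h2⟩ := hp
      obtain ⟨A', B', h3, h4⟩ := hq
      refine ⟨A + A', B + B', ?_, ?_⟩ <;> push_cast <;> rw [map_add]
      · rw [h1, h3]; ring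
      · rw [h2, h4]; ring
    | monomial n c hp =>
      obtain ⟨A, B, h1, h2⟩ := hp
      refine ⟨A * a + d * B * b, A * b + B * a, ?_, ?_⟩ <;> push_cast <;>
        rw [pow_succ, ← mul_assoc, map_mul, Polynomial.aeval_X]
      · rw [h1]; linear_combination B * b * hs
      · rw [h2]; linear_combination B * b * hs
  obtain ⟨p, hp, h0⟩ := h
  obtain ⟨A, B, h1, h2⟩ := key p
  rw [Polynomial.aeval_def, h0] at h1
  obtain ⟨rfl, rfl⟩ := irrational_sqrt_prime hd h1.symm
  exact ⟨p, hp, by rw [← Polynomial.aeval_def, h2]; simp⟩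

theorem exists_int_of_isIntegral_ratCast {q : ℚ} (h : IsIntegral ℤ (q : ℝ)) : ∃ n : ℤ, q = n := by
  have h' : IsIntegral ℤ q :=
    (isIntegral_algebraMap_iff (B := ℝ) (algebraMap ℚ ℝ).injective).1 h
  obtain ⟨n, hn⟩ := IsIntegrallyClosed.isIntegral_iff.1 h'
  exact ⟨n, by simpa using hn.symm⟩

/-- Trace and norm are integers, so `a` and `b` are at worst half-integers; a parity argument modulo
4 removes the halves. -/
theorem exists_int_of_isIntegral {d : ℕ} (hd : d.Prime) (hd4 : d % 4 = 3) {z : ℝ}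
    (hz : z ∈ RealQuadraticField d) (hi : IsIntegral ℤ z) :
    ∃ x y : ℤ, z = x + y * √(d : ℝ) := by
  have hs : √(d : ℝ) * √(d : ℝ) = d := Real.mul_self_sqrt (Nat.cast_nonneg d)
  obtain ⟨a, b, rfl⟩ := exists_rat_of_mem_realQuadraticField hz
  have hi' := isIntegral_conj hd hi
  obtain ⟨m, hm⟩ : ∃ m : ℤ, 2 * a = m := by
    apply exists_int_of_isIntegral_ratCast
    have : ((2 * a : ℚ) : ℝ) = (a + b * √(d : ℝ)) + (a - b * √(d : ℝ)) := by push_cast; ring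
    exact this ▸ hi.add hi'
  obtain ⟨n, hn⟩ : ∃ n : ℤ, a ^ 2 - d * b ^ 2 = n := by
    apply exists_int_of_isIntegral_ratCast
    have : ((a ^ 2 - d * b ^ 2 : ℚ) : ℝ) = (a + b * √(d : ℝ)) * (a - b * √(d : ℝ)) := by
      push_cast; linear_combination (b : ℝ) ^ 2 * hs
    exact this ▸ hi.mul hi'
  -- The square of `2bd` is the integer `d (m ^ 2 - 4n)`. Once `2bd` is an integer, primality of `d`
  -- cancels the factor `d`.
  obtain ⟨t, ht⟩ : ∃ t : ℤ, 2 * b * d = t := by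
    apply exists_int_of_isIntegral_ratCast
    refine IsIntegral.of_pow (n := 2) two_pos ?_
    convert isIntegral_algebraMap (R := ℤ) (A := ℝ) (x := d * (m ^ 2 - 4 * n)) using 1
    have : ((2 * b * d) ^ 2 : ℚ) = d * (m ^ 2 - 4 * n) := by
      rw [← hm, ← hn]; ring
    simpa using congrArg (Rat.cast : ℚ → ℝ) this
  have hdZ : Prime (d : ℤ) := Nat.prime_iff_prime_int.1 hd
  have hd0 : (d : ℚ) ≠ 0 := by exact_mod_cast hd.ne_zero
  have ht2 : t ^ 2 = d * (m ^ 2 - 4 * n) := by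
    have : (t ^ 2 : ℚ) = d * (m ^ 2 - 4 * n) := by rw [← hm, ← hn, ← ht]; ring
    exact_mod_cast this
  obtain ⟨s, rfl⟩ := hdZ.dvd_of_dvd_pow (Dvd.intro _ ht2.symm)
  have hb : 2 * b = s := by
    apply mul_right_cancel₀ hd0
    rw [ht]; push_cast; ring
  have hms : m ^ 2 - 4 * n = d * s ^ 2 := by
    apply mul_left_cancel₀ hdZ.ne_zero
    rw [← ht2]; ring
  have hk : (d : ℤ) = 4 * (d / 4 : ℕ) + 3 := by omega
  -- As `d ≡ -1 (mod 4)`, `m ^ 2 + s ^ 2 ≡ 0 (mod 4)`, which forces both to be even.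
  have hpar : m % 2 = 0 ∧ s % 2 = 0 := by
    have h4 : (m ^ 2 + s ^ 2) % 4 = 0 := by
      have : m ^ 2 + s ^ 2 = 4 * (n + ((d / 4 : ℕ) + 1) * s ^ 2) := by
        rw [hk] at hms; linear_combination hms
      omega
    rcases Int.even_or_odd' m with ⟨i, rfl | rfl⟩ <;>
      rcases Int.even_or_odd' s with ⟨j, rfl | rfl⟩ <;> ring_nf at h4 <;> omega
  obtain ⟨x, rfl⟩ := Int.dvd_of_emod_eq_zero hpar.1
  obtain ⟨y, rfl⟩ := Int.dvd_of_emod_eq_zero hpar.2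
  refine ⟨x, y, ?_⟩
  have ha' : a = x := by push_cast at hm; linarith
  have hb' : b = y := by push_cast at hb; linarith
  simp [ha', hb']

theorem isIntegral_sqrt_natCast (d : ℕ) : IsIntegral ℤ √(d : ℝ) := by
  refine IsIntegral.of_pow (n := 2) two_pos ?_
  rw [Real.sq_sqrt (Nat.cast_nonneg d)]
  exact isIntegral_algebraMap (R := ℤ) (x := (d : ℤ))

/-- The square root of `d`, as an element of the ring of integers of `ℚ(√d)`. -/
noncomputable def integralSqrt (d : ℕ) : 𝓞 (RealQuadraticField d) :=
  ⟨⟨√(d : ℝ), IntermediateField.mem_adjoin_simple_self ℚ _⟩,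
    (isIntegral_algebraMap_iff (B := ℝ)
      (algebraMap (RealQuadraticField d) ℝ).injective).1 (isIntegral_sqrt_natCast d)⟩

theorem coe_integralSqrt (d : ℕ) :
    (((integralSqrt d : 𝓞 (RealQuadraticField d)) : RealQuadraticField d) : ℝ) = √(d : ℝ) := rfl

theorem integralSqrt_mul_self (d : ℕ) : integralSqrt d * integralSqrt d = ((d : ℤ) : 𝓞 _) := by
  apply NumberField.RingOfIntegers.ext
  apply Subtype.ext
  simp [coe_integralSqrt]

/-- The ring homomorphism from `ℤ[√d]` to the ring of integers of `ℚ(√d)`. -/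
noncomputable def zsqrtdToRingOfIntegers (d : ℕ) : ℤ√(d : ℤ) →+* 𝓞 (RealQuadraticField d) :=
  Zsqrtd.lift ⟨integralSqrt d, integralSqrt_mul_self d⟩

theorem coe_zsqrtdToRingOfIntegers (d : ℕ) (w : ℤ√(d : ℤ)) :
    ((zsqrtdToRingOfIntegers d w : RealQuadraticField d) : ℝ) = w.re + w.im * √(d : ℝ) := by
  simp [zsqrtdToRingOfIntegers, coe_integralSqrt]

theorem exists_int_of_ringOfIntegers {d : ℕ} (hd : d.Prime) (hd4 : d % 4 = 3)
    (w : 𝓞 (RealQuadraticField d)) :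
    ∃ x y : ℤ, ((w : RealQuadraticField d) : ℝ) = x + y * √(d : ℝ) :=
  exists_int_of_isIntegral hd hd4 (w : RealQuadraticField d).2
    ((NumberField.RingOfIntegers.isIntegral_coe w).algebraMap (B := ℝ))

theorem ringOfIntegers_eq_adjoin_sqrt {d : ℕ} (hd : d.Prime) (hd4 : d % 4 = 3) (z : ℝ) :
    (∃ a : 𝓞 (RealQuadraticField d), ((a : RealQuadraticField d) : ℝ) = z) ↔
      z ∈ Algebra.adjoin ℤ {√(d : ℝ)} := by
  rw [mem_adjoin_int_sqrt_iff]
  constructor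
  · rintro ⟨a, rfl⟩
    exact exists_int_of_ringOfIntegers hd hd4 a
  · rintro ⟨x, y, rfl⟩
    exact ⟨zsqrtdToRingOfIntegers d ⟨x, y⟩, coe_zsqrtdToRingOfIntegers d _⟩

/-! ### Units and Pell solutions -/

theorem unitToReal_injective {d : ℕ} :
    Function.Injective (unitToReal : (𝓞 (RealQuadraticField d))ˣ → ℝ) := fun _ _ h =>
  Units.ext (NumberField.RingOfIntegers.ext (Subtype.ext h))

/-- The unit of the ring of integers of `ℚ(√d)` attached to a solution of Pell's equation. -/
noncomputable def pellUnit (d : ℕ) : Pell.Solution₁ (d : ℤ) →* (𝓞 (RealQuadraticField d))ˣ :=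
  (Units.map (zsqrtdToRingOfIntegers d).toMonoidHom).comp Unitary.toUnits

theorem unitToReal_pellUnit (d : ℕ) (a : Pell.Solution₁ (d : ℤ)) :
    unitToReal (pellUnit d a) = a.x + a.y * √(d : ℝ) :=
  coe_zsqrtdToRingOfIntegers d _

theorem pellUnit_neg (d : ℕ) (a : Pell.Solution₁ (d : ℤ)) : pellUnit d (-a) = -pellUnit d a := by
  apply Units.ext
  exact map_neg (zsqrtdToRingOfIntegers d) (a : ℤ√(d : ℤ))

theorem pellUnit_surjective {d : ℕ} (hd : d.Prime) (hd4 : d % 4 = 3) :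
    Function.Surjective (pellUnit d) := by
  intro u
  have hs : √(d : ℝ) * √(d : ℝ) = d := Real.mul_self_sqrt (Nat.cast_nonneg d)
  obtain ⟨x, y, hx⟩ := exists_int_of_ringOfIntegers hd hd4 (u : 𝓞 (RealQuadraticField d))
  obtain ⟨x', y', hx'⟩ := exists_int_of_ringOfIntegers hd hd4 (↑u⁻¹ : 𝓞 (RealQuadraticField d))
  have h1 : ((x : ℝ) + y * √(d : ℝ)) * (x' + y' * √(d : ℝ)) = 1 := by
    rw [← hx, ← hx']
    exact congrArg (fun w : 𝓞 (RealQuadraticField d) => ((w : RealQuadraticField d) : ℝ))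
      u.mul_inv
  obtain ⟨h2, h3⟩ := irrational_sqrt_prime hd
    (a := x * x' + d * y * y' - 1) (b := x * y' + y * x') (by
      push_cast; linear_combination h1 - y * y' * hs)
  norm_cast at h2 h3
  have hdvd : x ^ 2 - d * y ^ 2 ∣ 1 := ⟨x' ^ 2 - d * y' ^ 2, by
    have h4 : x * x' + d * y * y' = 1 := by linarith
    linear_combination -(x * x' + d * y * y' + 1) * h4 + d * (x * y' + y * x') * h3⟩
  have hk : (d : ℤ) = 4 * (d / 4 : ℕ) + 3 := by omega
  have hnorm : x ^ 2 - d * y ^ 2 = 1 := by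
    rcases Int.isUnit_iff.1 (isUnit_of_dvd_one hdvd) with h | h
    · exact h
    · exfalso
      -- Norm `-1` would make `-1` a sum of two squares modulo 4.
      have h4 : (x ^ 2 + y ^ 2 + 1) % 4 = 0 := by
        have : x ^ 2 + y ^ 2 + 1 = 4 * (((d / 4 : ℕ) + 1) * y ^ 2) := by
          rw [hk] at h; linear_combination h
        omega
      rcases Int.even_or_odd' x with ⟨i, rfl | rfl⟩ <;>
        rcases Int.even_or_odd' y with ⟨j, rfl | rfl⟩ <;> ring_nf at h4 <;> omega
  refine ⟨Pell.Solution₁.mk x y hnorm, unitToReal_injective ?_⟩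
  rw [unitToReal_pellUnit, Pell.Solution₁.x_mk, Pell.Solution₁.y_mk, ← hx]
  rfl

theorem isFundamentalUnit_pellUnit {d : ℕ} (hd : d.Prime) (hd4 : d % 4 = 3)
    {a : Pell.Solution₁ (d : ℤ)} (ha : Pell.IsFundamental a) :
    IsFundamentalUnit (pellUnit d a) := by
  refine ⟨?_, fun u => ?_⟩
  · rw [unitToReal_pellUnit]
    have h1 : (1 : ℝ) < a.x := by exact_mod_cast ha.1
    have h2 : (0 : ℝ) < a.y := by exact_mod_cast ha.2.1
    have := mul_nonneg h2.le (Real.sqrt_nonneg (d : ℝ))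
    linarith
  · obtain ⟨b, rfl⟩ := pellUnit_surjective hd hd4 u
    obtain ⟨n, hn | hn⟩ := ha.eq_zpow_or_neg_zpow b
    · exact ⟨n, Or.inl (by rw [hn, map_zpow])⟩
    · exact ⟨n, Or.inr (by rw [hn, pellUnit_neg, map_zpow])⟩

/-! ### Divisibility and growth of powers of a Pell solution -/

namespace Pell.Solution₁

/-- Binomial expansion of `(x + y√d) ^ n`: terms with at least two factors `√d` vanish modulo `d`.
-/
theorem dvd_y_pow_sub {d : ℤ} (a : Solution₁ d) (n : ℕ) :
    d ∣ (a ^ n).x - a.x ^ n ∧ d ∣ (a ^ (n + 1)).y - (n + 1) * a.x ^ n * a.y := by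
  induction n with
  | zero => simp
  | succ n ih =>
    obtain ⟨⟨i, hi⟩, ⟨j, hj⟩⟩ := ih
    have hx : d ∣ (a ^ (n + 1)).x - a.x ^ (n + 1) :=
      ⟨i * a.x + (a ^ n).y * a.y, by rw [pow_succ, x_mul]; linear_combination a.x * hi⟩
    refine ⟨hx, ?_⟩
    obtain ⟨k, hk⟩ := hx
    exact ⟨k * a.y + j * a.x, by
      rw [pow_succ a (n + 1), y_mul]; push_cast; linear_combination a.y * hk + a.x * hj⟩

/-- If the `y`-coordinate of a power of a solution is divisible by `d`, where the exponent is
positive and less than the prime `d`, then so is the `y`-coordinate of the solution. -/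
theorem dvd_y_of_dvd_y_pow {d : ℕ} (hd : d.Prime) (a : Solution₁ (d : ℤ)) {n : ℕ} (hn0 : n ≠ 0)
    (hn : n < d) (h : (d : ℤ) ∣ (a ^ n).y) : (d : ℤ) ∣ a.y := by
  obtain ⟨m, rfl⟩ := Nat.exists_eq_succ_of_ne_zero hn0
  have hp : Prime (d : ℤ) := Nat.prime_iff_prime_int.1 hd
  have h1 := (dvd_sub_right h).1 (a.dvd_y_pow_sub m).2
  rcases hp.dvd_or_dvd h1 with h2 | h2
  · exfalso
    rcases hp.dvd_or_dvd h2 with h3 | h3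
    · have : d ∣ m + 1 := by exact_mod_cast h3
      exact absurd (Nat.le_of_dvd (by omega) this) (by omega)
    · have h4 := hp.dvd_of_dvd_pow h3
      apply hp.not_dvd_one
      rw [← a.prop]
      exact dvd_sub (dvd_pow h4 two_ne_zero) (dvd_mul_right _ _)
  · exact h2

/-- Each multiplication gives `x_{n+1} = x_n x + d y_n y ≥ 2 x_n`. This crude bound limits the
exponent. -/
theorem two_pow_le_x_pow {d : ℤ} (hd : 0 ≤ d) {a : Solution₁ d} (hx : 1 < a.x) (hy : 0 < a.y)
    (n : ℕ) : 2 ^ n ≤ (a ^ n).x := by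
  induction n with
  | zero => simp
  | succ n ih =>
    have hyn : 0 ≤ (a ^ n).y := by
      cases n with
      | zero => simp
      | succ n => exact (y_pow_succ_pos (by omega) hy n).le
    rw [pow_succ, pow_succ, x_mul]
    have := mul_nonneg hd (mul_nonneg hyn hy.le)
    nlinarith [pow_pos (two_pos : (0 : ℤ) < 2) n]

end Pell.Solution₁

/-- A nontrivial solution of Pell's equation that is less than `2 ^ d` and whose `y`-coordinate is
divisible by the prime `d` forces `d` to divide the `y`-coordinate of the fundamental solution. -/
theorem Pell.IsFundamental.dvd_y {d : ℕ} (hd : d.Prime) {a b : Pell.Solution₁ (d : ℤ)}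
    (ha : Pell.IsFundamental a) (hb0 : b.y ≠ 0) (hb : (d : ℤ) ∣ b.y) (hbd : |b.x| < 2 ^ d) :
    (d : ℤ) ∣ a.y := by
  have hd0 : (0 : ℤ) < d := by exact_mod_cast hd.pos
  obtain ⟨c, hcx, hcy, hc⟩ := b.exists_pos_variant hd0
  have hxy : |c.x| = |b.x| ∧ |c.y| = |b.y| := by
    simp only [Set.mem_insert_iff, Set.mem_singleton_iff] at hc
    rcases hc with rfl | rfl | rfl | rfl <;> simp
  obtain ⟨n, rfl⟩ := ha.eq_pow_of_nonneg hcx hcy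
  have hn : n < d := by
    rw [← hxy.1, abs_of_pos hcx] at hbd
    exact (pow_lt_pow_iff_right₀ (one_lt_two : (1 : ℤ) < 2)).1
      ((Pell.Solution₁.two_pow_le_x_pow hd0.le ha.1 ha.2.1 n).trans_lt hbd)
  refine Pell.Solution₁.dvd_y_of_dvd_y_pow hd a ?_ hn ?_
  · rintro rfl
    exact hb0 (abs_eq_zero.1 (by simpa using hxy.2.symm))
  · rwa [← dvd_abs, hxy.2, dvd_abs]

/-! ### Primality of `d` -/

/-- `a ^ n % p` by repeated squaring, where `n` has at most `k` binary digits. -/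
def powMod (p a : ℕ) : ℕ → ℕ → ℕ
  | 0, _ => 1 % p
  | k + 1, n => a ^ (n % 2) * powMod p a k (n / 2) ^ 2 % p

theorem powMod_eq (p a : ℕ) {k n : ℕ} (hn : n < 2 ^ k) : powMod p a k n = a ^ n % p := by
  induction k generalizing n with
  | zero => obtain rfl : n = 0 := by simpa using hn
            rfl
  | succ k ih =>
    rw [powMod, ih (by omega)]
    conv_rhs => rw [← Nat.mod_add_div n 2, pow_add, mul_comm 2 (n / 2), pow_mul]
    exact Nat.ModEq.mul_left _ ((Nat.mod_modEq _ _).pow 2)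

/-- The Lucas primality test, in terms of `powMod`. -/
theorem Nat.prime_of_powMod {p : ℕ} (a k : ℕ) (hp : 1 < p) (hk : p < 2 ^ k)
    (ha : powMod p a k (p - 1) = 1)
    (h : ∀ q : ℕ, q.Prime → q ∣ p - 1 → powMod p a k ((p - 1) / q) ≠ 1) : p.Prime := by
  have key : ∀ n ≤ p, (a : ZMod p) ^ n = 1 ↔ powMod p a k n = 1 := fun n hn => by
    rw [← Nat.cast_pow, ← Nat.cast_one, ZMod.natCast_eq_natCast_iff, Nat.ModEq,
      Nat.mod_eq_of_lt hp, powMod_eq p a (hn.trans_lt hk)]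
  exact lucas_primality p a ((key _ (Nat.sub_le _ _)).2 ha) fun q hq hdvd h1 =>
    h q hq hdvd ((key _ ((Nat.div_le_self _ _).trans (Nat.sub_le _ _))).1 h1)

theorem prime_39028039587479 : Nat.Prime 39028039587479 := by
  -- 13 is a primitive root and `d < 2 ^ 46`; `d - 1 = 2 * 421 * 3187 * 3617 * 4021`.
  refine Nat.prime_of_powMod 13 46 (by norm_num) (by norm_num) (by decide +kernel)
    fun q hq hdvd => ?_
  have h : q ∣ 2 * 421 * 3187 * 3617 * 4021 := hdvd.trans (by norm_num)
  simp only [hq.dvd_mul, Nat.prime_dvd_prime_iff_eq hq (by norm_num : Nat.Prime 2),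
    Nat.prime_dvd_prime_iff_eq hq (by norm_num : Nat.Prime 421),
    Nat.prime_dvd_prime_iff_eq hq (by norm_num : Nat.Prime 3187),
    Nat.prime_dvd_prime_iff_eq hq (by norm_num : Nat.Prime 3617),
    Nat.prime_dvd_prime_iff_eq hq (by norm_num : Nat.Prime 4021)] at h
  rcases h with (((rfl | rfl) | rfl) | rfl) | rfl <;> decide +kernel

/-! ### The counterexample -/

theorem exists_isFundamentalUnit_dvd :
    ∃ ε : (𝓞 (RealQuadraticField 39028039587479))ˣ, IsFundamentalUnit ε ∧
      ∃ x y : ℕ,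
        unitToReal ε = (x : ℝ) + (y : ℝ) * Real.sqrt ((39028039587479 : ℕ) : ℝ) ∧
        39028039587479 ∣ y := by
  have hd := prime_39028039587479
  -- With `d` a variable, `2 ^ d` stays symbolic.
  generalize hdef : 39028039587479 = d at hd ⊢
  have hdZ : (39028039587479 : ℤ) = d := by exact_mod_cast hdef
  have hd4 : d % 4 = 3 := by omega
  obtain ⟨a, ha⟩ := Pell.IsFundamental.exists_of_not_isSquare (d := (d : ℤ))
    (by exact_mod_cast hd.pos) (Nat.prime_iff_prime_int.1 hd).not_isSquare
  obtain ⟨B, hB, X, Y, hnorm, -, -, ⟨k, hk⟩, hX, -⟩ := generatorResidues_final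
  rw [hdZ] at hnorm hk
  rw [hdef] at hB
  have hdvd : (d : ℤ) ∣ a.y := by
    refine ha.dvd_y hd (b := Pell.Solution₁.mk X Y hnorm) ?_ ?_ ?_
    · rw [Pell.Solution₁.y_mk]
      rintro rfl
      -- `Y = 0` would give `d ∣ 24152907212873`, a positive number less than `d`.
      have : (d : ℤ) * 24152907212873 = d * (d * -k) := by linear_combination -hk
      have := mul_left_cancel₀ (by exact_mod_cast hd.ne_zero) this
      rw [← hdZ] at this
      omega
    · rw [Pell.Solution₁.y_mk]
      exact ⟨24152907212873 + d * k, by linear_combination hk⟩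
    · rw [Pell.Solution₁.x_mk]
      exact hX.trans_lt (pow_lt_pow_right₀ one_lt_two hB)
  obtain ⟨x, hx⟩ := Int.eq_ofNat_of_zero_le ha.x_pos.le
  obtain ⟨y, hy⟩ := Int.eq_ofNat_of_zero_le ha.2.1.le
  refine ⟨pellUnit d a, isFundamentalUnit_pellUnit hd hd4 ha, x, y, ?_, ?_⟩
  · rw [unitToReal_pellUnit, hx, hy, Int.cast_natCast, Int.cast_natCast]
  · rw [hy] at hdvd
    exact_mod_cast hdvd

theorem mainTheorem1 :
    Nat.Prime 39028039587479 ∧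
    39028039587479 ≡ 3 [MOD 4] ∧
    (∀ z : ℝ, (∃ a : 𝓞 (RealQuadraticField 39028039587479),
        ((a : RealQuadraticField 39028039587479) : ℝ) = z) ↔
      z ∈ Algebra.adjoin ℤ {Real.sqrt ((39028039587479 : ℕ) : ℝ)}) ∧
    (∃ ε : (𝓞 (RealQuadraticField 39028039587479))ˣ, IsFundamentalUnit ε ∧
      ∃ x y : ℕ,
        unitToReal ε = (x : ℝ) + (y : ℝ) * Real.sqrt ((39028039587479 : ℕ) : ℝ) ∧
        39028039587479 ∣ y) ∧
    ¬ MordellPellianConjecture := by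
  refine ⟨prime_39028039587479, rfl,
    ringOfIntegers_eq_adjoin_sqrt prime_39028039587479 (by norm_num),
    exists_isFundamentalUnit_dvd, fun h => ?_⟩
  obtain ⟨ε, hε, x, y, hxy, hdvd⟩ := exists_isFundamentalUnit_dvd
  exact h _ prime_39028039587479 rfl ε hε x y hxy hdvd
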